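/- All groups are finite. For a group $G$ write $G' = [G,G]$ and $G_3 = [G',G]$. Call $G$ a Camina group if for every $g \in G \setminus G'$ the conjugacy class of $g$ equals the coset $gG'$. Let $p$ be a prime and let $G$ be a finite $p$-group that is a Camina group and has nilpotence class exactly $3$. If $|G_3| > |G':G_3|^{1/2}$, then $C_G(G') = G'$. -/

import Mathlib

open scoped Pointwise

/-- A group `G` is a Camina group if the conjugacy class of every `g` outside the derived subgroup
`G'` is the full coset `g G'`. -/
def IsCaminaGroup (G : Type*) [Group G] : Prop :=
  ∀ g : G, g ∉ commutator G → conjugatesOf g = g • (commutator G : Set G)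

/-- The third term `G₃ = [G', G]` of the lower central series `G₁ = G`, `G₂ = G'`. -/
def thirdTerm (G : Type*) [Group G] : Subgroup G := ⁅commutator G, (⊤ : Subgroup G)⁆

/-! Write `C = C_G(G')`. The three subgroups lemma gives `G' ≤ C`. If some `a ∈ C` lies outside
`G'`, then `|G₃|² ≤ |C : G'| ≤ |G : C| ≤ |G' : G₃|`, against the hypothesis.

Last inequality (`index_centralizer_le`): `w ↦ ⁅a, w⁆` is injective from cosets of `C` to cosets of
`G₃`. Middle one (`relIndex_centralizer_sq_le`): `C / G'` is isotropic for the commutator pairing of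
`G / Z(G)`, so `|C : G'|² ≤ |G : G'|`. First one (`card_thirdTerm_sq_le`): `C` has class two and
center `G'`, and every noncentral row of its commutator pairing covers `G₃`. Composing with any
nonzero functional on `G₃` then gives a nondegenerate form. The Pfaffian of this family of forms
vanishes only at zero, and Chevalley–Warning bounds the number of its variables by its degree. -/

open scoped commutatorElement IsMulCommutative

/-! ### Alternating determinants. -/

/-- The determinant of an alternating matrix over a field is a square. -/
theorem Matrix.isSquare_det_of_alternating {K : Type*} [Field K] :
    ∀ (n : ℕ) {ι : Type*} [Fintype ι] [DecidableEq ι] (M : Matrix ι ι K),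
      Fintype.card ι = n → (∀ i, M i i = 0) → (∀ i j, M j i = -M i j) → IsSquare M.det := by
  intro n
  induction n using Nat.strong_induction_on with
  | _ n ih =>
  intro ι _ _ M hn hdiag hskew
  by_cases hM : ∀ i j, M i j = 0
  · have hM0 : M = 0 := by ext i j; exact hM i j
    subst hM0
    cases isEmpty_or_nonempty ι
    · simp
    · rw [Matrix.det_zero]; exact IsSquare.zero
  push Not at hM
  obtain ⟨i, j, hij⟩ := hM
  have hne : i ≠ j := by rintro rfl; exact hij (hdiag i)
  -- Split off the block on rows `i, j`: the determinant is `c²` times that of the Schur complement,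
  -- which is again alternating and smaller.
  set c := M i j with hc
  let f : Fin 2 ⊕ {k // k ≠ i ∧ k ≠ j} → ι := Sum.elim ![i, j] Subtype.val
  have hf : Function.Bijective f := by
    constructor
    · rintro (a | ⟨a, ha⟩) (b | ⟨b, hb⟩) hab
      · fin_cases a <;> fin_cases b <;>
          first | rfl | exact (hne hab).elim | exact (hne hab.symm).elim
      · fin_cases a <;> simp [f] at hab <;> grind
      · fin_cases b <;> simp [f] at hab <;> grind
      · simpa [f] using hab
    · intro k
      by_cases h1 : k = i
      · exact ⟨Sum.inl 0, by simp [f, h1]⟩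
      by_cases h2 : k = j
      · exact ⟨Sum.inl 1, by simp [f, h2]⟩
      · exact ⟨Sum.inr ⟨k, h1, h2⟩, rfl⟩
  let e := Equiv.ofBijective f hf
  set N := M.submatrix e e with hN
  have hdet : M.det = N.det := (Matrix.det_submatrix_equiv_self e M).symm
  have hA : N.toBlocks₁₁ = !![0, c; -c, 0] := by
    ext a b
    fin_cases a <;> fin_cases b <;>
      simp [N, Matrix.toBlocks₁₁, e, f, hdiag, hc, hskew i j]
  let A' : Matrix (Fin 2) (Fin 2) K := !![0, -c⁻¹; c⁻¹, 0]
  have hinv : A' * N.toBlocks₁₁ = 1 := by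
    rw [hA]
    ext a b
    fin_cases a <;> fin_cases b <;> simp [A', Matrix.mul_apply, hij]
  let _ : Invertible N.toBlocks₁₁ := ⟨A', hinv, mul_eq_one_comm.mp hinv⟩
  have hinv' : ⅟ N.toBlocks₁₁ = A' := rfl
  rw [hdet, ← Matrix.fromBlocks_toBlocks N, Matrix.det_fromBlocks₁₁, hinv']
  refine IsSquare.mul ⟨c, by rw [hA]; simp [Matrix.det_fin_two]⟩ ?_
  have hS : ∀ k l, (N.toBlocks₂₂ - N.toBlocks₂₁ * A' * N.toBlocks₁₂) k l =
      M k l - (M k j * M i l - M k i * M j l) * c⁻¹ := by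
    intro k l
    simp [N, A', Matrix.mul_apply, Matrix.toBlocks₂₂, Matrix.toBlocks₂₁, Matrix.toBlocks₁₂, e, f]
    ring
  refine ih (Fintype.card {k // k ≠ i ∧ k ≠ j}) ?_ _ rfl ?_ ?_
  · rw [← hn]
    exact Fintype.card_subtype_lt (x := i) (by simp)
  · intro k
    rw [hS, hdiag, hskew k i, hskew k j]
    ring
  · intro k l
    rw [hS, hS, hskew k l, hskew k i, hskew k j, hskew i l, hskew j l]
    ring

/-- An alternating matrix over a unique factorization domain has square determinant. -/
theorem Matrix.isSquare_det_of_alternating_ufd {R : Type*} [CommRing R] [IsDomain R]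
    [UniqueFactorizationMonoid R] {ι : Type*} [Fintype ι] [DecidableEq ι] (M : Matrix ι ι R)
    (hdiag : ∀ i, M i i = 0) (hskew : ∀ i j, M j i = -M i j) : IsSquare M.det := by
  obtain ⟨s, hs⟩ := Matrix.isSquare_det_of_alternating _
    ((algebraMap R (FractionRing R)).mapMatrix M) rfl (by simp [hdiag])
    (by intro i j; simp [hskew i j])
  rw [← RingHom.map_det] at hs
  -- The root in the fraction field is integral over `R`, and a UFD is integrally closed.
  obtain ⟨r, hr⟩ := IsIntegrallyClosed.exists_algebraMap_eq_of_isIntegral_pow (R := R)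
    (x := s) (n := 2) two_pos (by rw [sq, ← hs]; exact isIntegral_algebraMap)
  refine ⟨r, IsFractionRing.injective R (FractionRing R) ?_⟩
  rw [hs, map_mul, hr]

theorem Matrix.totalDegree_det_le {σ R ι : Type*} [CommRing R] [Fintype ι] [DecidableEq ι]
    (M : Matrix ι ι (MvPolynomial σ R)) (hM : ∀ i j, (M i j).totalDegree ≤ 1) :
    M.det.totalDegree ≤ Fintype.card ι := by
  rw [Matrix.det_apply]
  refine (MvPolynomial.totalDegree_finsetSum _ _).trans (Finset.sup_le fun τ _ => ?_)
  refine (MvPolynomial.totalDegree_smul_le _ _).trans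
    ((MvPolynomial.totalDegree_finsetProd _ _).trans ?_)
  exact (Finset.sum_le_sum fun i _ => hM _ _).trans (by simp)

/-! ### Dimension bounds for bilinear maps. -/

/-- If `β : V × V → U` is alternating over a finite field and `β v` is onto for every `v ≠ 0`, then
`2 dim U ≤ dim V`. -/
theorem LinearMap.two_mul_finrank_le_of_isAlt_of_surjective {K V U : Type*} [Field K] [Finite K]
    [AddCommGroup V] [Module K V] [FiniteDimensional K V] [Nontrivial V]
    [AddCommGroup U] [Module K U] [FiniteDimensional K U]
    (β : V →ₗ[K] V →ₗ[K] U) (halt : ∀ v, β v v = 0)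
    (hsurj : ∀ v, v ≠ 0 → Function.Surjective (β v)) :
    2 * Module.finrank K U ≤ Module.finrank K V := by
  classical
  have := Fintype.ofFinite K
  have hskew : ∀ v w, β w v = -β v w := by
    intro v w
    have h := halt (v + w)
    simp only [map_add, LinearMap.add_apply, halt, zero_add, add_zero] at h
    exact eq_neg_of_add_eq_zero_left h
  let b := Module.finBasis K V
  let c := Module.finBasis K U
  -- Gram matrix of `β` followed by the generic functional on `U`; `P` below is its Pfaffian up to
  -- sign.
  let M : Matrix (Fin (Module.finrank K V)) (Fin (Module.finrank K V))
      (MvPolynomial (Fin (Module.finrank K U)) K) :=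
    fun i j => ∑ k, MvPolynomial.C (c.repr (β (b i) (b j)) k) * MvPolynomial.X k
  have hMdiag : ∀ i, M i i = 0 := by intro i; simp [M, halt]
  have hMskew : ∀ i j, M j i = -M i j := by
    intro i j; simp [M, hskew (b i) (b j), Finset.sum_neg_distrib]
  obtain ⟨P, hP⟩ := Matrix.isSquare_det_of_alternating_ufd M hMdiag hMskew
  have hdeg : M.det.totalDegree ≤ Module.finrank K V := by
    have h := Matrix.totalDegree_det_le M (fun i j => by
      refine (MvPolynomial.totalDegree_finsetSum _ _).trans (Finset.sup_le fun k _ => ?_)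
      refine (MvPolynomial.totalDegree_mul _ _).trans ?_
      simp)
    simpa using h
  let φ : (Fin (Module.finrank K U) → K) → U →ₗ[K] K := fun x => c.constr K x
  have heval : ∀ x, MvPolynomial.eval x M.det =
      (LinearMap.toMatrix₂ b b (β.compr₂ (φ x))).det := by
    intro x
    rw [RingHom.map_det]
    congr 1
    ext i j
    change MvPolynomial.eval x (M i j) = _
    simp [M, φ, LinearMap.toMatrix₂_apply, Module.Basis.constr_apply_fintype]
  -- For `x ≠ 0` the form `φ x ∘ β` is nondegenerate, since each nonzero row of `β` is onto.
  have hzero : ∀ x, MvPolynomial.eval x P = 0 ↔ x = 0 := by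
    intro x
    have h1 : MvPolynomial.eval x P = 0 ↔ MvPolynomial.eval x M.det = 0 := by
      rw [hP, map_mul, mul_self_eq_zero]
    rw [h1, heval]
    constructor
    · intro hdet
      by_contra hx
      have hφ : φ x ≠ 0 := by
        intro h0
        apply hx
        ext k
        have : φ x (c k) = x k := by simp [φ]
        rw [← this, h0]; rfl
      obtain ⟨u, hu⟩ : ∃ u, φ x u ≠ 0 := by
        by_contra! h; exact hφ (LinearMap.ext h)
      obtain ⟨w, hw, hw0⟩ := Matrix.exists_vecMul_eq_zero_iff.mpr hdet
      let v := b.equivFun.symm w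
      have hv : v ≠ 0 := (map_ne_zero_iff _ b.equivFun.symm.injective).2 hw
      obtain ⟨y, hy⟩ := hsurj v hv u
      apply hu
      rw [← hy]
      have key : (φ x).comp (β v) = 0 := by
        refine b.ext fun j => ?_
        have := congrFun hw0 j
        simpa [Matrix.vecMul, dotProduct, LinearMap.toMatrix₂_apply, v,
          Module.Basis.equivFun_symm_apply] using this
      exact LinearMap.congr_fun key y
    · rintro rfl
      have : φ 0 = 0 := by simp [φ]
      rw [this]
      have h0 : LinearMap.toMatrix₂ b b (β.compr₂ (0 : U →ₗ[K] K)) = 0 := by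
        ext i j; simp [LinearMap.toMatrix₂_apply]
      rw [h0]
      have : Nonempty (Fin (Module.finrank K V)) := ⟨⟨0, Module.finrank_pos⟩⟩
      exact Matrix.det_zero
  by_contra! hlt
  obtain ⟨p, hp⟩ := CharP.exists K
  have hpp : p ≠ 1 := CharP.char_ne_one K p
  have hP2 : 2 * P.totalDegree ≤ Module.finrank K V := by
    by_cases hP0 : P = 0
    · simp [hP0]
    · rw [hP, MvPolynomial.totalDegree_mul_of_isDomain hP0 hP0] at hdeg
      omega
  -- Chevalley–Warning: `deg P < dim U` makes `p` divide the number of zeros, which is one.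
  have hdvd := char_dvd_card_solutions p (f := P) (by rw [Fintype.card_fin]; omega)
  have hcard : Fintype.card {x // MvPolynomial.eval x P = 0} = 1 := by
    rw [Fintype.card_eq_one_iff]
    exact ⟨⟨0, (hzero 0).2 rfl⟩, fun y => Subtype.ext ((hzero _).1 y.2)⟩
  rw [hcard, Nat.dvd_one] at hdvd
  exact hpp hdvd

/-- A totally isotropic subspace of a nondegenerate form has at most half the dimension. -/
theorem LinearMap.two_mul_finrank_isotropic_le {K V : Type*} [Field K]
    [AddCommGroup V] [Module K V] [FiniteDimensional K V]
    (B : V →ₗ[K] V →ₗ[K] K) (hB : ∀ v, v ≠ 0 → ∃ w, B v w ≠ 0)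
    (A : Submodule K V) (hA : ∀ v ∈ A, ∀ w ∈ A, B v w = 0) :
    2 * Module.finrank K A ≤ Module.finrank K V := by
  -- Nondegeneracy embeds `A` in its annihilator, of dimension `dim V - dim A`.
  let f : A →ₗ[K] Module.Dual K V := B.comp A.subtype
  have hf : ∀ a, f a ∈ A.dualAnnihilator := by
    intro a
    rw [Submodule.mem_dualAnnihilator]
    exact fun w hw => hA a a.2 w hw
  have hinj : Function.Injective (f.codRestrict A.dualAnnihilator hf) := by
    refine (injective_iff_map_eq_zero _).2 ?_
    intro a ha
    by_contra h0
    obtain ⟨w, hw⟩ := hB a (by simpa using h0)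
    have := congrArg (fun g => (g : V →ₗ[K] K) w) (congrArg Subtype.val ha)
    exact hw (by simpa [f] using this)
  have h1 := LinearMap.finrank_le_finrank_of_injective hinj
  have h2 := Subspace.finrank_add_finrank_dualAnnihilator_eq A
  omega

/-! ### Pairings on groups. -/

/-- An alternating pairing on a group descends to its image, which is the quotient by the radical. -/
theorem MonoidHom.exists_pairing_range {H T : Type*} [Group H] [CommGroup T] (κ : H →* H →* T)
    (halt : ∀ h, κ h h = 1) :
    ∃ B : κ.range →* κ.range →* T, ∀ h g, B (κ.rangeRestrict h) (κ.rangeRestrict g) = κ h g := by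
  have hskew : ∀ h g, κ h g = (κ g h)⁻¹ := by
    intro h g
    have := halt (h * g)
    rw [map_mul κ, MonoidHom.mul_apply, map_mul, map_mul, halt, halt, one_mul, mul_one] at this
    exact eq_inv_of_mul_eq_one_left this
  choose s hs using κ.rangeRestrict_surjective
  have hs' : ∀ φ : κ.range, κ (s φ) = φ := fun φ => congrArg Subtype.val (hs φ)
  -- Skew symmetry trades `s ψ` for `s φ`, so multiplicativity in `ψ` holds although `s` need not be
  -- a homomorphism.
  have hval : ∀ φ ψ : κ.range, (φ : H →* T) (s ψ) = ((ψ : H →* T) (s φ))⁻¹ := by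
    intro φ ψ
    have := hskew (s φ) (s ψ)
    rwa [hs', hs'] at this
  refine ⟨MonoidHom.mk' (fun φ => MonoidHom.mk' (fun ψ => (φ : H →* T) (s ψ)) ?_) ?_, ?_⟩
  · intro ψ χ
    rw [hval, Subgroup.coe_mul, MonoidHom.mul_apply, mul_inv, ← hval, ← hval]
  · intro φ ψ
    ext χ
    simp
  · intro h g
    change κ h (s (κ.rangeRestrict g)) = κ h g
    rw [hskew, hs', hskew h g]
    rfl

/-- An alternating pairing into an elementary abelian `p`-group, linearized over `ZMod p`. -/
theorem MonoidHom.exists_linear_pairing {H T : Type*} [Group H] [CommGroup T] (p : ℕ)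
    [Fact p.Prime]
    (κ : H →* H →* T) (halt : ∀ h, κ h h = 1)
    [Module (ZMod p) (Additive T)] [Module (ZMod p) (Additive κ.range)] :
    ∃ B : Additive κ.range →ₗ[ZMod p] Additive κ.range →ₗ[ZMod p] Additive T,
      ∀ h g, B (Additive.ofMul (κ.rangeRestrict h)) (Additive.ofMul (κ.rangeRestrict g)) =
        Additive.ofMul (κ h g) := by
  obtain ⟨B, hB⟩ := κ.exists_pairing_range halt
  let f (x : Additive κ.range) : Additive κ.range →+ Additive T :=
    MonoidHom.toAdditive (B x.toMul)
  let f' (y : Additive κ.range) : Additive κ.range →+ Additive T :=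
    MonoidHom.toAdditive (B.flip y.toMul)
  refine ⟨LinearMap.mk₂ (ZMod p) (fun x y => f x y) (fun x x' y => map_add (f' y) x x')
    (fun c x y => ZMod.map_smul (f' y) c x) (fun x y y' => map_add (f x) y y')
    (fun c x y => ZMod.map_smul (f x) c y), ?_⟩
  intro h g
  exact congrArg Additive.ofMul (hB h g)

theorem Nat.card_eq_pow_finrank_zmod (p : ℕ) [Fact p.Prime] (V : Type*) [AddCommGroup V]
    [Module (ZMod p) V] [Finite V] : Nat.card V = p ^ Module.finrank (ZMod p) V := by
  rw [Module.natCard_eq_pow_finrank (K := ZMod p), Nat.card_zmod]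

theorem MonoidHom.pow_range_eq_one {H T : Type*} [Group H] [CommGroup T] {p : ℕ}
    (hT : ∀ t : T, t ^ p = 1) (κ : H →* H →* T) (φ : κ.range) : φ ^ p = 1 := by
  ext g
  simp [hT]

/-- If an alternating pairing into an elementary abelian `p`-group takes, on each row outside
its radical, every value in `U`, then `|U|²` is at most the index of the radical. -/
theorem MonoidHom.card_sq_le_index_ker {H T : Type*} [Group H] [CommGroup T] [Finite H] [Finite T]
    (p : ℕ) [Fact p.Prime] (κ : H →* H →* T) [Module (ZMod p) (Additive T)]
    [Module (ZMod p) (Additive κ.range)] (halt : ∀ h, κ h h = 1)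
    (U : Subgroup T) (hU : ∀ h, κ h ≠ 1 → ∀ u ∈ U, ∃ g, κ h g = u) (hne : κ ≠ 1) :
    Nat.card U ^ 2 ≤ κ.ker.index := by
  have : Finite (Additive κ.range) :=
    Finite.of_surjective (fun h => Additive.ofMul (κ.rangeRestrict h)) κ.rangeRestrict_surjective
  obtain ⟨B, hB⟩ := κ.exists_linear_pairing p halt
  let U' : Submodule (ZMod p) (Additive T) := AddSubgroup.toZModSubmodule p (Subgroup.toAddSubgroup U)
  -- Values may leave `U`; a linear retraction onto `U` keeps the nonzero rows onto.
  obtain ⟨r, hr⟩ := U'.subtype.exists_leftInverse_of_injective U'.ker_subtype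
  have : Nontrivial (Additive κ.range) := by
    obtain ⟨h, hh⟩ : ∃ h, κ h ≠ 1 := by
      by_contra! h; exact hne (MonoidHom.ext h)
    exact ⟨Additive.ofMul (κ.rangeRestrict h), 0, fun h0 => hh (congrArg Subtype.val h0)⟩
  have key := LinearMap.two_mul_finrank_le_of_isAlt_of_surjective (B.compr₂ r) (by
      intro v
      obtain ⟨h, hh⟩ := κ.rangeRestrict_surjective v.toMul
      obtain rfl : Additive.ofMul (κ.rangeRestrict h) = v := hh
      rw [LinearMap.compr₂_apply, hB, halt]
      exact map_zero r) (by
      intro v hv u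
      obtain ⟨h, hh⟩ := κ.rangeRestrict_surjective v.toMul
      obtain rfl : Additive.ofMul (κ.rangeRestrict h) = v := hh
      obtain ⟨g, hg⟩ := hU h (fun h0 => hv (Subtype.ext h0)) _ u.2
      refine ⟨Additive.ofMul (κ.rangeRestrict g), ?_⟩
      rw [LinearMap.compr₂_apply, hB, hg]
      exact LinearMap.congr_fun hr u)
  have hU' : Nat.card U = p ^ Module.finrank (ZMod p) U' := Nat.card_eq_pow_finrank_zmod p U'
  have hV : κ.ker.index = p ^ Module.finrank (ZMod p) (Additive κ.range) := by
    rw [Subgroup.index_ker]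
    exact Nat.card_eq_pow_finrank_zmod p (Additive κ.range)
  rw [hU', hV, ← pow_mul, mul_comm]
  exact Nat.pow_le_pow_right (Fact.out : p.Prime).pos key

/-- A totally isotropic subgroup for an alternating pairing into an elementary abelian `p`-group,
each nontrivial row of which takes a fixed nontrivial value. -/
theorem MonoidHom.relIndex_sq_le_index_ker {H T : Type*} [Group H] [CommGroup T] [Finite H]
    [Finite T] (p : ℕ) [Fact p.Prime] (κ : H →* H →* T) [Module (ZMod p) (Additive T)]
    [Module (ZMod p) (Additive κ.range)] (halt : ∀ h, κ h h = 1) (u : T) (hu : u ≠ 1) (hU : ∀ h, κ h ≠ 1 → ∃ g, κ h g = u)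
    (A : Subgroup H) (hA : ∀ a ∈ A, ∀ b ∈ A, κ a b = 1) :
    κ.ker.relIndex A ^ 2 ≤ κ.ker.index := by
  have : Finite (Additive κ.range) :=
    Finite.of_surjective (fun h => Additive.ofMul (κ.rangeRestrict h)) κ.rangeRestrict_surjective
  obtain ⟨B, hB⟩ := κ.exists_linear_pairing p halt
  -- A functional not killing `u` turns `B` into a nondegenerate scalar form.
  obtain ⟨l, hl⟩ : ∃ l : Module.Dual (ZMod p) (Additive T), l (Additive.ofMul u) ≠ 0 := by
    by_contra! h
    exact hu ((Module.forall_dual_apply_eq_zero_iff (ZMod p) (Additive.ofMul u)).1 h)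
  let A' : Submodule (ZMod p) (Additive κ.range) :=
    AddSubgroup.toZModSubmodule p (Subgroup.toAddSubgroup (A.map κ.rangeRestrict))
  have key := LinearMap.two_mul_finrank_isotropic_le (B.compr₂ l) (by
      intro v hv
      obtain ⟨h, hh⟩ := κ.rangeRestrict_surjective v.toMul
      obtain rfl : Additive.ofMul (κ.rangeRestrict h) = v := hh
      obtain ⟨g, hg⟩ := hU h (fun h0 => hv (Subtype.ext h0))
      refine ⟨Additive.ofMul (κ.rangeRestrict g), ?_⟩
      rwa [LinearMap.compr₂_apply, hB, hg]) A' (by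
      rintro v ⟨a, ha, hav⟩ w ⟨b, hb, hbw⟩
      obtain rfl : Additive.ofMul (κ.rangeRestrict a) = v := hav
      obtain rfl : Additive.ofMul (κ.rangeRestrict b) = w := hbw
      rw [LinearMap.compr₂_apply, hB, hA a ha b hb]
      exact map_zero l)
  have hA' : κ.ker.relIndex A = p ^ Module.finrank (ZMod p) A' := by
    rw [← Nat.card_eq_pow_finrank_zmod p A', ← κ.ker_rangeRestrict, Subgroup.relIndex_ker]
    rfl
  have hV : κ.ker.index = p ^ Module.finrank (ZMod p) (Additive κ.range) := by
    rw [Subgroup.index_ker]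
    exact Nat.card_eq_pow_finrank_zmod p (Additive κ.range)
  rw [hA', hV, ← pow_mul, mul_comm]
  exact Nat.pow_le_pow_right (Fact.out : p.Prime).pos key

/-! ### Groups of class two. -/

/-- In a group of nilpotence class at most two, the commutator is a bimultiplicative pairing. -/
def commPairing {H : Type*} [Group H] (hc : commutator H ≤ Subgroup.center H) :
    H →* H →* Subgroup.center H :=
  have hmem : ∀ h g : H, ⁅h, g⁆ ∈ Subgroup.center H := fun h g =>
    hc (Subgroup.commutator_mem_commutator (Subgroup.mem_top h) (Subgroup.mem_top g))
  MonoidHom.mk' (fun h => MonoidHom.mk' (fun g => ⟨⁅h, g⁆, hmem h g⟩) (by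
      intro g g'
      ext
      have h1 : ⁅h, g * g'⁆ = ⁅h, g⁆ * (g * ⁅h, g'⁆ * g⁻¹) := by
        simp only [commutatorElement_def]; group
      rw [Subgroup.mem_center_iff.1 (hmem h g') g, mul_inv_cancel_right] at h1
      exact h1)) (by
    intro h h'
    ext g
    have h1 : ⁅h * h', g⁆ = h * ⁅h', g⁆ * h⁻¹ * ⁅h, g⁆ := by
      simp only [commutatorElement_def]; group
    rw [Subgroup.mem_center_iff.1 (hmem h' g) h, mul_inv_cancel_right,
      Subgroup.mem_center_iff.1 (hmem h g)] at h1
    exact h1)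

theorem Subgroup.mem_center_iff_commutatorElement {H : Type*} [Group H] {h : H} :
    h ∈ Subgroup.center H ↔ ∀ g : H, ⁅h, g⁆ = 1 := by
  simp_rw [Subgroup.mem_center_iff, commutatorElement_eq_one_iff_mul_comm, eq_comm]

theorem torsion_pow_eq_one {H : Type*} [Group H] (p : ℕ)
    (t : (powMonoidHom p : Subgroup.center H →* Subgroup.center H).ker) : t ^ p = 1 :=
  Subtype.ext t.2

/-- The `p`-torsion commutator pairing of a class two group that has exponent `p` modulo its
center. -/
theorem exists_commPairing_torsion {H : Type*} [Group H] (p : ℕ)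
    (hc : commutator H ≤ Subgroup.center H) (hp : ∀ h : H, h ^ p ∈ Subgroup.center H) :
    ∃ κ : H →* H →* (powMonoidHom p : Subgroup.center H →* Subgroup.center H).ker,
      (∀ h g, ((κ h g : Subgroup.center H) : H) = ⁅h, g⁆) ∧ κ.ker = Subgroup.center H := by
  -- `⁅h, g⁆ ^ p = ⁅h ^ p, g⁆ = 1`, as `h ^ p` is central.
  have hmem : ∀ h g, commPairing hc h g ∈
      (powMonoidHom p : Subgroup.center H →* Subgroup.center H).ker := by
    intro h g
    rw [MonoidHom.mem_ker, powMonoidHom_apply, ← MonoidHom.pow_apply, ← map_pow]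
    ext
    exact Subgroup.mem_center_iff_commutatorElement.1 (hp h) g
  refine ⟨MonoidHom.mk' (fun h => (commPairing hc h).codRestrict _ (hmem h)) ?_, ?_, ?_⟩
  · intro h h'
    ext g
    simp
  · intro h g
    rfl
  · ext h
    rw [Subgroup.mem_center_iff_commutatorElement, MonoidHom.mem_ker, MonoidHom.ext_iff]
    simp only [Subtype.ext_iff]
    rfl

/-- If `⁅h, H⁆ ⊇ U` for all noncentral `h` in a class two group `H`, then `|U|² ≤ |H : Z(H)|`. -/
theorem card_sq_le_index_center {H : Type*} [Group H] [Finite H] (p : ℕ) [Fact p.Prime]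
    (hc : commutator H ≤ Subgroup.center H) (hp : ∀ h : H, h ^ p ∈ Subgroup.center H)
    (hne : Subgroup.center H ≠ ⊤) (U : Subgroup H)
    (hU : ∀ h ∉ Subgroup.center H, ∀ u ∈ U, ∃ g, ⁅h, g⁆ = u) :
    Nat.card U ^ 2 ≤ (Subgroup.center H).index := by
  obtain ⟨κ, hκ, hker⟩ := exists_commPairing_torsion p hc hp
  obtain ⟨h₀, hh₀⟩ : ∃ h, h ∉ Subgroup.center H := by
    by_contra! h; exact hne (eq_top_iff.2 fun x _ => h x)
  let ι : (powMonoidHom p : Subgroup.center H →* Subgroup.center H).ker →* H :=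
    (Subgroup.center H).subtype.comp (Subgroup.subtype _)
  have hι : Function.Injective ι := Subtype.val_injective.comp Subtype.val_injective
  have hUι : U ≤ ι.range := by
    intro u hu
    obtain ⟨g, rfl⟩ := hU h₀ hh₀ u hu
    exact ⟨κ h₀ g, hκ h₀ g⟩
  have hcard : Nat.card U = Nat.card (U.comap ι) := by
    rw [← Subgroup.card_map_of_injective hι, Subgroup.map_comap_eq_self hUι]
  have hindex : (Subgroup.center H).index = κ.ker.index := by rw [hker]
  rw [hcard, hindex]
  let _ := AddCommGroup.zmodModule (n := p) (G := Additive _) (torsion_pow_eq_one (H := H) p)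
  let _ := AddCommGroup.zmodModule (n := p) (G := Additive κ.range)
    (κ.pow_range_eq_one (torsion_pow_eq_one p))
  refine κ.card_sq_le_index_ker p ?_ _ ?_ ?_
  · intro h
    exact hι ((hκ h h).trans (commutatorElement_self h))
  · intro h hh u hu
    obtain ⟨g, hg⟩ := hU h (by rwa [← hker, MonoidHom.mem_ker]) _ hu
    exact ⟨g, hι ((hκ h g).trans hg)⟩
  · intro h1
    apply hne
    rw [← hker, h1]
    exact MonoidHom.ker_one

/-- If `u ∈ ⁅h, H⁆` for all noncentral `h` in a class two group `H`, where `u ≠ 1`, then an abelian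
subgroup `A` satisfies `|A : A ∩ Z(H)|² ≤ |H : Z(H)|`. -/
theorem relIndex_center_sq_le_index_center {H : Type*} [Group H] [Finite H] (p : ℕ)
    [Fact p.Prime] (hc : commutator H ≤ Subgroup.center H)
    (hp : ∀ h : H, h ^ p ∈ Subgroup.center H) (u : H) (hu : u ≠ 1)
    (hU : ∀ h ∉ Subgroup.center H, ∃ g, ⁅h, g⁆ = u)
    (A : Subgroup H) (hA : ∀ a ∈ A, ∀ b ∈ A, ⁅a, b⁆ = 1) :
    (Subgroup.center H).relIndex A ^ 2 ≤ (Subgroup.center H).index := by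
  by_cases hne : Subgroup.center H = ⊤
  · simp [hne]
  obtain ⟨κ, hκ, hker⟩ := exists_commPairing_torsion p hc hp
  obtain ⟨h₀, hh₀⟩ : ∃ h, h ∉ Subgroup.center H := by
    by_contra! h; exact hne (eq_top_iff.2 fun x _ => h x)
  have hι : Function.Injective
      (fun t : (powMonoidHom p : Subgroup.center H →* Subgroup.center H).ker =>
        ((t : Subgroup.center H) : H)) := Subtype.val_injective.comp Subtype.val_injective
  obtain ⟨g₀, hg₀⟩ := hU h₀ hh₀
  have hindex : (Subgroup.center H).index = κ.ker.index := by rw [hker]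
  have hrel : (Subgroup.center H).relIndex A = κ.ker.relIndex A := by rw [hker]
  rw [hindex, hrel]
  let _ := AddCommGroup.zmodModule (n := p) (G := Additive _) (torsion_pow_eq_one (H := H) p)
  let _ := AddCommGroup.zmodModule (n := p) (G := Additive κ.range)
    (κ.pow_range_eq_one (torsion_pow_eq_one p))
  refine κ.relIndex_sq_le_index_ker p ?_ (κ h₀ g₀) ?_ ?_ A ?_
  · intro h
    exact hι ((hκ h h).trans (commutatorElement_self h))
  · intro h1
    apply hu
    rw [← hg₀, ← hκ, h1]
    rfl
  · intro h hh
    obtain ⟨g, hg⟩ := hU h (by rwa [← hker, MonoidHom.mem_ker])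
    exact ⟨g, hι ((hκ h g).trans (hg.trans (hg₀.symm.trans (hκ h₀ g₀).symm)))⟩
  · intro a ha b hb
    exact hι ((hκ a b).trans (hA a ha b hb))

/-! ### Camina groups and the centralizer of `G'`. -/

theorem commutatorElement_mem_commutator {G : Type*} [Group G] (g h : G) :
    ⁅g, h⁆ ∈ commutator G :=
  Subgroup.commutator_mem_commutator (Subgroup.mem_top g) (Subgroup.mem_top h)

/-- In a Camina group every element outside the derived subgroup has all elements of the derived
subgroup as commutators. -/
theorem IsCaminaGroup.exists_commutatorElement_eq {G : Type*} [Group G] (hcam : IsCaminaGroup G)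
    {g : G} (hg : g ∉ commutator G) {u : G} (hu : u ∈ commutator G) : ∃ c, ⁅g, c⁆ = u := by
  have h1 : g⁻¹ * u ∈ conjugatesOf g⁻¹ := by
    rw [hcam g⁻¹ (by rwa [inv_mem_iff])]
    exact Set.smul_mem_smul_set hu
  obtain ⟨c, hc⟩ := isConj_iff.1 h1
  exact ⟨c, by rw [commutatorElement_def, mul_assoc, mul_assoc, ← mul_assoc c, hc,
    mul_inv_cancel_left]⟩

/-- A class two `p`-group in which `⁅h, H⁆` is the derived subgroup for all `h` outside it has
abelianization of exponent `p`. -/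
theorem pow_mem_commutator_of_classTwo {H : Type*} [Group H] [Finite H] {p : ℕ} [Fact p.Prime]
    (hpH : IsPGroup p H) (hc : commutator H ≤ Subgroup.center H) (hne : commutator H ≠ ⊥)
    (hsurj : ∀ h ∉ commutator H, ∀ u ∈ commutator H, ∃ g, ⁅h, g⁆ = u) (h : H) :
    h ^ p ∈ commutator H := by
  by_contra hh
  -- `⁅h ^ p, g⁆ = ⁅h, g⁆ ^ p` would make the `p`-th power map onto, hence injective, on `H'`,
  -- against Cauchy.
  let f : commutator H → commutator H := fun x => x ^ p
  have hf : Function.Surjective f := by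
    rintro ⟨u, hu⟩
    obtain ⟨g, hg⟩ := hsurj _ hh u hu
    refine ⟨⟨⁅h, g⁆, commutatorElement_mem_commutator h g⟩, Subtype.ext ?_⟩
    have h1 : commPairing hc (h ^ p) g = commPairing hc h g ^ p := by
      rw [map_pow, MonoidHom.pow_apply]
    exact (congrArg Subtype.val h1).symm.trans hg
  have hinj := Finite.injective_iff_surjective.2 hf
  have : Nontrivial (commutator H) := (Subgroup.nontrivial_iff_ne_bot _).2 hne
  have hdvd : p ∣ Nat.card (commutator H) := by
    obtain ⟨n, hn0, hn⟩ := (hpH.to_subgroup (commutator H)).nontrivial_iff_card.1 this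
    rw [hn]
    exact dvd_pow_self p hn0.ne'
  obtain ⟨x, hx⟩ := exists_prime_orderOf_dvd_card' p hdvd
  have hx1 : x = 1 := hinj (by
    change x ^ p = 1 ^ p
    rw [one_pow, ← hx, pow_orderOf_eq_one])
  rw [hx1, orderOf_one] at hx
  exact (Fact.out : p.Prime).ne_one hx.symm

theorem conj_commutatorElement {G : Type*} [Group G] (w a y : G) :
    w * ⁅a, y⁆ * w⁻¹ = ⁅w * a * w⁻¹, w * y * w⁻¹⁆ := by
  simp only [commutatorElement_def]; group

section

variable {G : Type*} [Group G]

theorem mem_centralizer_commutator_iff {a : G} :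
    a ∈ Subgroup.centralizer (commutator G : Set G) ↔ ∀ d ∈ commutator G, d * a = a * d := by
  rw [Subgroup.mem_centralizer_iff]; rfl

/-- Three subgroups lemma for `G, G, G'`, using `⁅G₃, G⁆ = 1`. -/
theorem commutator_le_centralizer_commutator (hU : thirdTerm G ≤ Subgroup.center G) :
    commutator G ≤ Subgroup.centralizer (commutator G : Set G) := by
  have h1 : ⁅thirdTerm G, (⊤ : Subgroup G)⁆ = ⊥ := by
    rwa [Subgroup.commutator_eq_bot_iff_le_centralizer, Subgroup.coe_top,
      Subgroup.centralizer_univ]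
  rw [← Subgroup.commutator_eq_bot_iff_le_centralizer]
  conv_lhs => rw [commutator_def]
  apply Subgroup.commutator_commutator_eq_bot_of_rotate
  · rwa [Subgroup.commutator_comm ⊤ ⁅(⊤ : Subgroup G), (⊤ : Subgroup G)⁆]
  · exact h1

/-- An element whose commutator with `a` is central centralizes `⁅a, G⁆`, if `a` centralizes
`G'`. -/
theorem mul_commutatorElement_comm (hU : thirdTerm G ≤ Subgroup.center G) {a w : G}
    (ha : a ∈ Subgroup.centralizer (commutator G : Set G))
    (hw : ⁅a, w⁆ ∈ Subgroup.center G) (y : G) : ⁅a, y⁆ * w = w * ⁅a, y⁆ := by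
  have hD := commutator_le_centralizer_commutator hU
  set z := ⁅a, w⁆ with hz
  have h1 : w * a * w⁻¹ = z⁻¹ * a := by
    rw [hz, commutatorElement_def]; group
  have h2 : w * y * w⁻¹ = ⁅w, y⁆ * y := by
    rw [commutatorElement_def]; group
  -- Conjugation by `w` multiplies `a` by a central element and `y` by an element of `G'`; neither
  -- changes `⁅a, y⁆`.
  have h3 : w * ⁅a, y⁆ * w⁻¹ = ⁅a, y⁆ := by
    rw [conj_commutatorElement, h1, h2]
    have hzc := Subgroup.mem_center_iff_commutatorElement.1 (inv_mem hw)
    have hd : ⁅w, y⁆ ∈ commutator G := commutatorElement_mem_commutator w y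
    set d := ⁅w, y⁆
    have e1 : ⁅z⁻¹ * a, d * y⁆ = z⁻¹ * ⁅a, d * y⁆ * z⁻¹⁻¹ * ⁅z⁻¹, d * y⁆ := by
      simp only [commutatorElement_def]; group
    have e2 : ⁅a, d * y⁆ = ⁅a, d⁆ * (d * ⁅a, y⁆ * d⁻¹) := by
      simp only [commutatorElement_def]; group
    have e3 : ⁅a, d⁆ = 1 := by
      rw [commutatorElement_eq_one_iff_mul_comm]
      exact (mem_centralizer_commutator_iff.1 ha d hd).symm
    have e4 : d * ⁅a, y⁆ = ⁅a, y⁆ * d :=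
      mem_centralizer_commutator_iff.1 (hD (commutatorElement_mem_commutator a y)) d hd
    rw [e1, hzc, mul_one, e2, e3, one_mul, e4, mul_inv_cancel_right,
      ← Subgroup.mem_center_iff.1 (inv_mem hw), mul_inv_cancel_right]
  rw [mul_inv_eq_iff_eq_mul] at h3
  exact h3.symm

/-- Conjugation changes `a` and `c` by factors in `G'`, which commute with `a`, `c` and each other.
This makes the image of `C` in `G / Z(G)` abelian. -/
theorem commutatorElement_mem_center_of_mem_centralizer
    (hU : thirdTerm G ≤ Subgroup.center G) {a c : G}
    (ha : a ∈ Subgroup.centralizer (commutator G : Set G))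
    (hc : c ∈ Subgroup.centralizer (commutator G : Set G)) : ⁅a, c⁆ ∈ Subgroup.center G := by
  have hD := commutator_le_centralizer_commutator hU
  rw [Subgroup.mem_center_iff]
  intro y
  have h1 : y * a * y⁻¹ = ⁅y, a⁆ * a := by rw [commutatorElement_def]; group
  have h2 : y * c * y⁻¹ = ⁅y, c⁆ * c := by rw [commutatorElement_def]; group
  have h3 : y * ⁅a, c⁆ * y⁻¹ = ⁅a, c⁆ := by
    rw [conj_commutatorElement, h1, h2]
    have hd : ⁅y, a⁆ ∈ commutator G := commutatorElement_mem_commutator y a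
    have he : ⁅y, c⁆ ∈ commutator G := commutatorElement_mem_commutator y c
    set d := ⁅y, a⁆
    set e := ⁅y, c⁆
    have hac := mem_centralizer_commutator_iff.1 (hD (commutatorElement_mem_commutator a c))
    have e1 : ⁅d * a, e * c⁆ = d * ⁅a, e * c⁆ * d⁻¹ * ⁅d, e * c⁆ := by
      simp only [commutatorElement_def]; group
    have e2 : ⁅a, e * c⁆ = ⁅a, e⁆ * (e * ⁅a, c⁆ * e⁻¹) := by
      simp only [commutatorElement_def]; group
    have e3 : ⁅a, e⁆ = 1 := by
      rw [commutatorElement_eq_one_iff_mul_comm]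
      exact (mem_centralizer_commutator_iff.1 ha e he).symm
    have e4 : ⁅d, e * c⁆ = 1 := by
      rw [commutatorElement_eq_one_iff_mul_comm]
      exact mem_centralizer_commutator_iff.1 (mul_mem (hD he) hc) d hd
    rw [e1, e2, e3, e4, one_mul, mul_one, hac e he, mul_inv_cancel_right, hac d hd,
      mul_inv_cancel_right]
  rwa [mul_inv_eq_iff_eq_mul] at h3

variable (hcam : IsCaminaGroup G)

include hcam

theorem IsCaminaGroup.center_le_commutator (hne : commutator G ≠ ⊥) :
    Subgroup.center G ≤ commutator G := by
  intro z hz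
  by_contra h
  apply hne
  rw [eq_bot_iff]
  intro u hu
  obtain ⟨c, rfl⟩ := hcam.exists_commutatorElement_eq h hu
  exact Subgroup.mem_center_iff_commutatorElement.1 hz c

/-- The elements `⁅a, y⁆` exhaust `G'`, and `w` commutes with each of them. -/
theorem IsCaminaGroup.mem_centralizer_commutator (hU : thirdTerm G ≤ Subgroup.center G) {a w : G}
    (ha : a ∈ Subgroup.centralizer (commutator G : Set G)) (haD : a ∉ commutator G)
    (hw : ⁅a, w⁆ ∈ Subgroup.center G) : w ∈ Subgroup.centralizer (commutator G : Set G) := by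
  rw [mem_centralizer_commutator_iff]
  intro d hd
  obtain ⟨y, rfl⟩ := hcam.exists_commutatorElement_eq haD hd
  exact mul_commutatorElement_comm hU ha hw y

/-- If `C = C_G(G')` is larger than `G'` in a class three Camina group, then
`|G : C| ≤ |G' : G₃|`. -/
theorem IsCaminaGroup.index_centralizer_le [Finite G] (hU : thirdTerm G ≤ Subgroup.center G) {a : G}
    (ha : a ∈ Subgroup.centralizer (commutator G : Set G)) (haD : a ∉ commutator G) :
    (Subgroup.centralizer (commutator G : Set G)).index ≤
      (thirdTerm G).relIndex (commutator G) := by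
  let f : G ⧸ Subgroup.centralizer (commutator G : Set G) →
      commutator G ⧸ (thirdTerm G).subgroupOf (commutator G) :=
    fun q => QuotientGroup.mk ⟨⁅a, q.out⁆, commutatorElement_mem_commutator _ _⟩
  refine Nat.card_le_card_of_injective f fun q r hqr => ?_
  have h1 : ⁅a, q.out⁆⁻¹ * ⁅a, r.out⁆ ∈ thirdTerm G :=
    Subgroup.mem_subgroupOf.1 (QuotientGroup.eq.1 hqr)
  -- Equal images thus make `⁅a, q⁻¹r⁆` central, so `q⁻¹r ∈ C`.
  have h2 : ⁅a, q.out⁆⁻¹ * ⁅a, r.out⁆ = q.out * ⁅a, q.out⁻¹ * r.out⁆ * q.out⁻¹ := by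
    simp only [commutatorElement_def]; group
  rw [h2] at h1
  have h3 := (Subgroup.instNormalCenter (G := G)).conj_mem _ (hU h1) q.out⁻¹
  rw [inv_inv, mul_assoc, mul_assoc, mul_assoc, inv_mul_cancel, mul_one, inv_mul_cancel_left] at h3
  rw [← QuotientGroup.out_eq' q, ← QuotientGroup.out_eq' r, QuotientGroup.eq]
  exact hcam.mem_centralizer_commutator hU ha haD h3

end

/-! ### The quotient by the center, and the index bounds. -/

section quotient

variable {G : Type*} [Group G] (hcam : IsCaminaGroup G) (hU : thirdTerm G ≤ Subgroup.center G)
  (hDZ : ¬ commutator G ≤ Subgroup.center G)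

include hcam hDZ in
theorem IsCaminaGroup.mem_commutator_quotient_center_iff {g : G} :
    (g : G ⧸ Subgroup.center G) ∈ commutator (G ⧸ Subgroup.center G) ↔ g ∈ commutator G := by
  have hne : commutator G ≠ ⊥ := by
    intro h; exact hDZ (h ▸ bot_le)
  have hZ := hcam.center_le_commutator hne
  have hmap : commutator (G ⧸ Subgroup.center G) =
      (commutator G).map (QuotientGroup.mk' (Subgroup.center G)) := by
    rw [commutator_def, commutator_def, Subgroup.map_commutator,
      Subgroup.map_top_of_surjective _ (QuotientGroup.mk'_surjective _)]
  rw [hmap]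
  change g ∈ ((commutator G).map (QuotientGroup.mk' (Subgroup.center G))).comap
    (QuotientGroup.mk' (Subgroup.center G)) ↔ _
  rw [Subgroup.comap_map_eq, QuotientGroup.ker_mk', sup_eq_left.2 hZ]

include hcam hDZ in
theorem IsCaminaGroup.quotient_center_exists {h : G ⧸ Subgroup.center G}
    (hh : h ∉ commutator (G ⧸ Subgroup.center G)) {u : G ⧸ Subgroup.center G}
    (hu : u ∈ commutator (G ⧸ Subgroup.center G)) : ∃ g, ⁅h, g⁆ = u := by
  obtain ⟨h, rfl⟩ := QuotientGroup.mk_surjective h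
  obtain ⟨u, rfl⟩ := QuotientGroup.mk_surjective u
  rw [hcam.mem_commutator_quotient_center_iff hDZ] at hh hu
  obtain ⟨c, rfl⟩ := hcam.exists_commutatorElement_eq hh hu
  exact ⟨c, rfl⟩

include hcam hDZ in
theorem IsCaminaGroup.commutator_quotient_center_ne_bot :
    commutator (G ⧸ Subgroup.center G) ≠ ⊥ := by
  obtain ⟨d, hd, hdZ⟩ := SetLike.not_le_iff_exists.1 hDZ
  intro h
  have := (hcam.mem_commutator_quotient_center_iff hDZ).2 hd
  rw [h, Subgroup.mem_bot, QuotientGroup.eq_one_iff] at this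
  exact hdZ this

include hcam hU hDZ in
theorem IsCaminaGroup.center_quotient_center :
    Subgroup.center (G ⧸ Subgroup.center G) = commutator (G ⧸ Subgroup.center G) := by
  apply le_antisymm
  · intro h hh
    by_contra hD
    apply hcam.commutator_quotient_center_ne_bot hDZ
    rw [eq_bot_iff]
    intro u hu
    obtain ⟨g, rfl⟩ := hcam.quotient_center_exists hDZ hD hu
    exact Subgroup.mem_center_iff_commutatorElement.1 hh g
  · intro d hd
    obtain ⟨d, rfl⟩ := QuotientGroup.mk_surjective d
    rw [hcam.mem_commutator_quotient_center_iff hDZ] at hd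
    rw [Subgroup.mem_center_iff_commutatorElement]
    intro g
    obtain ⟨g, rfl⟩ := QuotientGroup.mk_surjective g
    exact (QuotientGroup.eq_one_iff (N := Subgroup.center G) ⁅d, g⁆).2
      (hU (Subgroup.commutator_mem_commutator hd (Subgroup.mem_top g)))

variable [Finite G] {p : ℕ} [Fact p.Prime] (hpG : IsPGroup p G)

include hcam hU hDZ hpG

theorem IsCaminaGroup.pow_mem_commutator (g : G) : g ^ p ∈ commutator G := by
  rw [← hcam.mem_commutator_quotient_center_iff hDZ]
  exact pow_mem_commutator_of_classTwo (hpG.to_quotient _)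
    (hcam.center_quotient_center hU hDZ).ge (hcam.commutator_quotient_center_ne_bot hDZ)
    (fun h hh u hu => hcam.quotient_center_exists hDZ hh hu) g

/-- In a class three Camina `p`-group, `|C : G'|² ≤ |G : G'|` where `C = C_G(G')`. -/
theorem IsCaminaGroup.relIndex_centralizer_sq_le :
    (commutator G).relIndex (Subgroup.centralizer (commutator G : Set G)) ^ 2 ≤
      (commutator G).index := by
  have hcenter := hcam.center_quotient_center hU hDZ
  have hcomap : (Subgroup.center (G ⧸ Subgroup.center G)).comap
      (QuotientGroup.mk' (Subgroup.center G)) = commutator G := by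
    rw [hcenter]
    ext g
    exact hcam.mem_commutator_quotient_center_iff hDZ
  have hbot := hcam.commutator_quotient_center_ne_bot hDZ
  obtain ⟨⟨u, hu⟩, hu1⟩ := Subgroup.ne_bot_iff_exists_ne_one.1 hbot
  have key := relIndex_center_sq_le_index_center p hcenter.ge (by
      intro h
      obtain ⟨g, rfl⟩ := QuotientGroup.mk_surjective h
      rw [hcenter]
      exact (hcam.mem_commutator_quotient_center_iff hDZ).2
        (hcam.pow_mem_commutator hU hDZ hpG g)) u (fun h => hu1 (Subtype.ext h)) (by
      intro h hh
      rw [hcenter] at hh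
      exact hcam.quotient_center_exists hDZ hh hu)
    ((Subgroup.centralizer (commutator G : Set G)).map (QuotientGroup.mk' (Subgroup.center G))) (by
      rintro _ ⟨a, ha, rfl⟩ _ ⟨b, hb, rfl⟩
      exact (QuotientGroup.eq_one_iff (N := Subgroup.center G) ⁅a, b⁆).2
        (commutatorElement_mem_center_of_mem_centralizer hU ha hb))
  rwa [← Subgroup.relIndex_comap, ← Subgroup.index_comap_of_surjective _
    (QuotientGroup.mk'_surjective (Subgroup.center G)), hcomap] at key

/-- In a class three Camina `p`-group, `|G₃|² ≤ |C : G'|` if `C = C_G(G')` is larger than `G'`. -/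
theorem IsCaminaGroup.card_thirdTerm_sq_le {a : G}
    (ha : a ∈ Subgroup.centralizer (commutator G : Set G)) (haD : a ∉ commutator G) :
    Nat.card (thirdTerm G) ^ 2 ≤
      (commutator G).relIndex (Subgroup.centralizer (commutator G : Set G)) := by
  have hUD : thirdTerm G ≤ commutator G := Subgroup.commutator_le_left _ _
  have hDC := commutator_le_centralizer_commutator hU
  set C := Subgroup.centralizer (commutator G : Set G) with hC
  -- A solution `g` in `G` of `⁅h, g⁆ = u` lies in `C`, because `u` is central.
  have hsurj : ∀ h : C, (h : G) ∉ commutator G → ∀ u ∈ thirdTerm G,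
      ∃ g : C, ⁅(h : G), (g : G)⁆ = u := by
    intro h hh u hu
    obtain ⟨g, hg⟩ := hcam.exists_commutatorElement_eq hh (hUD hu)
    exact ⟨⟨g, hcam.mem_centralizer_commutator hU h.2 hh (hg ▸ hU hu)⟩, hg⟩
  have hUne : ∃ u ∈ thirdTerm G, u ≠ 1 := by
    by_contra! h
    apply hDZ
    intro d hd
    rw [Subgroup.mem_center_iff_commutatorElement]
    exact fun g => h _ (Subgroup.commutator_mem_commutator hd (Subgroup.mem_top g))
  have hcenter : Subgroup.center C = (commutator G).subgroupOf C := by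
    ext h
    rw [Subgroup.mem_center_iff_commutatorElement, Subgroup.mem_subgroupOf]
    constructor
    · intro h1
      by_contra hh
      obtain ⟨u, hu, hu1⟩ := hUne
      obtain ⟨g, hg⟩ := hsurj h hh u hu
      exact hu1 (hg.symm.trans (congrArg Subtype.val (h1 g)))
    · intro hh g
      rw [commutatorElement_eq_one_iff_mul_comm]
      exact Subtype.ext (mem_centralizer_commutator_iff.1 g.2 h hh)
  have hcomm : commutator C ≤ Subgroup.center C := by
    rw [commutator_def, Subgroup.commutator_le]
    intro x _ y _
    rw [hcenter, Subgroup.mem_subgroupOf]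
    exact commutatorElement_mem_commutator (x : G) (y : G)
  have key := card_sq_le_index_center p hcomm (by
      intro h
      rw [hcenter, Subgroup.mem_subgroupOf]
      exact hcam.pow_mem_commutator hU hDZ hpG (h : G)) (by
      intro htop
      rw [hcenter, Subgroup.subgroupOf_eq_top] at htop
      exact haD (htop ha)) ((thirdTerm G).subgroupOf C) (by
      intro h hh u hu
      rw [hcenter] at hh
      obtain ⟨g, hg⟩ := hsurj h hh u hu
      exact ⟨g, Subtype.ext hg⟩)
  rw [Nat.card_congr (Subgroup.subgroupOfEquivOfLe (hUD.trans hDC)).toEquiv] at key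
  have hindex : (Subgroup.center C).index = (commutator G).relIndex C := by rw [hcenter]; rfl
  rwa [hindex] at key

end quotient

/-! ### Class three, and the conclusion. -/

theorem thirdTerm_le_center_of_nilpotencyClass_eq_three {G : Type*} [Group G] [Group.IsNilpotent G]
    (hcls : Group.nilpotencyClass G = 3) : thirdTerm G ≤ Subgroup.center G := by
  have h := Subgroup.lowerCentralSeries_eq_bot_iff_nilpotencyClass_le.2 hcls.le
  -- The series is indexed from `0`, so its term `3` is `⁅G₃, G⁆`.
  rw [Subgroup.lowerCentralSeries_succ, Subgroup.lowerCentralSeries_succ,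
    Subgroup.top_lowerCentralSeries_one, Subgroup.commutator_eq_bot_iff_le_centralizer,
    Subgroup.coe_top, Subgroup.centralizer_univ] at h
  exact h

theorem not_commutator_le_center_of_nilpotencyClass_eq_three {G : Type*} [Group G]
    [Group.IsNilpotent G] (hcls : Group.nilpotencyClass G = 3) :
    ¬ commutator G ≤ Subgroup.center G := by
  intro h
  have h2 : (⊤ : Subgroup G).lowerCentralSeries 2 = ⊥ := by
    rwa [Subgroup.lowerCentralSeries_succ, Subgroup.top_lowerCentralSeries_one,
      Subgroup.commutator_eq_bot_iff_le_centralizer, Subgroup.coe_top, Subgroup.centralizer_univ]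
  have := Subgroup.lowerCentralSeries_eq_bot_iff_nilpotencyClass_le.1 h2
  omega

theorem corollary3p10 (p : ℕ) (hp : p.Prime) (G : Type*) [Group G] [Finite G]
    (hpG : IsPGroup p G) (hcam : IsCaminaGroup G)
    (hcls : Group.nilpotencyClass G = 3)
    (hcard : (Nat.card (thirdTerm G) : ℝ) >
      Real.sqrt ((thirdTerm G).relIndex (commutator G) : ℝ)) :
    Subgroup.centralizer (commutator G : Set G) = commutator G := by
  have : Fact p.Prime := ⟨hp⟩
  have : Group.IsNilpotent G := hpG.isNilpotent
  have hU := thirdTerm_le_center_of_nilpotencyClass_eq_three hcls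
  have hDZ := not_commutator_le_center_of_nilpotencyClass_eq_three hcls
  have hDC := commutator_le_centralizer_commutator hU
  refine le_antisymm (fun a ha => ?_) hDC
  by_contra haD
  have h1 := hcam.relIndex_centralizer_sq_le hU hDZ hpG
  have h2 := hcam.card_thirdTerm_sq_le hU hDZ hpG ha haD
  have h3 := hcam.index_centralizer_le hU ha haD
  rw [← Subgroup.relIndex_mul_index hDC, sq] at h1
  -- Cancelling `|C : G'|` leaves `|C : G'| ≤ |G : C|`.
  have h4 := Nat.le_of_mul_le_mul_left h1
    (Nat.pos_of_ne_zero Subgroup.index_ne_zero_of_finite)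
  have h5 := (h2.trans h4).trans h3
  refine absurd hcard (not_lt.2 (Real.le_sqrt_of_sq_le ?_))
  exact_mod_cast h5
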